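/- Let $T\colon X\to X$ be a continuous map on a compact metric space $(X,\rho)$, let $\Phi=\{\phi_1,\dots,\phi_d\}$ be a family of continuous functions $\phi_i\colon X\to\mathbb R$, and let $\mathcal M$ be the set of $T$-invariant Borel probability measures on $X$ with the weak$^*$ topology. For $\mu\in\mathcal M$ let $h_\mu(T)$ be the Kolmogorov--Sinai entropy and $\int_X\Phi\,d\mu=(\int_X\phi_1\,d\mu,\dots,\int_X\phi_d\,d\mu)$. For a continuous function $\phi\colon X\to\mathbb R$ let $$P(\phi)=\lim_{\epsilon\to0}\limsup_{n\to\infty}\frac1n\log\sup_E\sum_{x\in E}\exp\sum_{k=0}^{n-1}\phi(T^kx)$$ be its topological pressure, the supremum being over all $(n,\epsilon)$-separated sets $E$ (that is, $\max_{0\le k<n}\rho(T^kx,T^ky)>\epsilon$ for all distinct $x,y\in E$); an equilibrium measure for $\phi$ is a measure $\mu\in\mathcal M$ with $P(\phi)=h_\mu(T)+\int_X\phi\,d\mu$. Put $$L(\Phi)=\Bigl\{\int_X\Phi\,d\mu:\mu\in\mathcal M\Bigr\}\subset\mathbb R^d,\qquad h(z)=\sup\Bigl\{h_\mu(T):\mu\in\mathcal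 M,\ \int_X\Phi\,d\mu=z\Bigr\}\quad(z\in L(\Phi)).$$ Let $2\le r\le\omega$ (so $r$ is an integer, $\infty$ or $\omega$, the last meaning real analytic) and suppose that the pair $(T,\Phi)$ is $C^r$-regular, that is: 1. each function in $\operatorname{span}\{\phi_1,\dots,\phi_d,1\}$ has a unique equilibrium measure; 2. for each $z\in\operatorname{int}L(\Phi)$ the map $\mathbb R^d\ni q\mapsto P(\langle q,\Phi-z\rangle)$ is real valued, of class $C^r$ and strictly convex, and its second derivative at each $q\in\mathbb R^d$ is a positive definite bilinear form; 3. the entropy map $\mathcal M\ni\mu\mapsto h_\mu(T)$ is real valued and upper semicontinuous. Then $h$ is finite, upper semicontinuous and concave on $L(\Phi)$ (in particular, $L(\Phi)$ is convex). -/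

import Mathlib

open MeasureTheory Filter Topology Set
open scoped ENNReal ContDiff

noncomputable section

namespace NonlinearPressure

/-! ### Kolmogorov–Sinai entropy

A finite measurable partition of `X` is given by a measurable labelling `ξ : X → Fin k`; its cells
are the fibres of `ξ` (empty cells are harmless because `0 log 0 = 0`). -/

section Entropy

variable {X : Type*} [MeasurableSpace X]

/-- The labelling of the joined partition `⋁_{i < n} T⁻ⁱ ξ`. -/
def joinedLabel {k : ℕ} (T : X → X) (ξ : X → Fin k) (n : ℕ) : X → (Fin n → Fin k) :=
  fun x i => ξ (T^[i] x)

/-- Shannon entropy `H_μ(η) = -∑ μ(C) log μ(C)` of the finite partition into the fibres of `η`. -/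
def partitionEntropy {ι : Type*} [Fintype ι] (μ : Measure X) (η : X → ι) : ℝ :=
  ∑ a, Real.negMulLog (μ.real (η ⁻¹' {a}))

/-- The entropy `h_μ(T, ξ) = lim (1/n) H_μ(⋁_{i < n} T⁻ⁱ ξ)` of a partition. For an invariant
probability measure the sequence `n ↦ H_μ(⋁_{i < n} T⁻ⁱ ξ)` is subadditive, so the limit exists
and coincides with the lower limit. -/
def entropyOfPartition {k : ℕ} (T : X → X) (μ : Measure X) (ξ : X → Fin k) : ℝ≥0∞ :=
  liminf (fun n : ℕ => ENNReal.ofReal (partitionEntropy μ (joinedLabel T ξ n) / n)) atTop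

/-- The Kolmogorov–Sinai entropy `h_μ(T)`: the supremum of `h_μ(T, ξ)` over all finite measurable
partitions `ξ`. -/
def metricEntropy (T : X → X) (μ : Measure X) : ℝ≥0∞ :=
  ⨆ (k : ℕ) (ξ : X → Fin k) (_ : Measurable ξ), entropyOfPartition T μ ξ

/-- The set of `T`-invariant probability measures. -/
def invariantMeasures (T : X → X) : Set (ProbabilityMeasure X) :=
  {μ | MeasurePreserving T (μ : Measure X) (μ : Measure X)}

end Entropy

/-! ### Classical topological pressure -/

section Pressure

variable {X : Type*} [MetricSpace X]

/-- `E` is `(n, ε)`-separated: `max_{k < n} d(Tᵏ x, Tᵏ y) > ε` for distinct `x, y ∈ E`.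
(In a compact space such sets are automatically finite.) -/
def IsSeparated (T : X → X) (n : ℕ) (ε : ℝ) (E : Finset X) : Prop :=
  ∀ x ∈ E, ∀ y ∈ E, x ≠ y → ∃ k < n, ε < dist (T^[k] x) (T^[k] y)

/-- `sup_E ∑_{x ∈ E} exp (S_n φ(x))` over all `(n, ε)`-separated sets `E`. -/
def separatedSum (T : X → X) (φ : C(X, ℝ)) (n : ℕ) (ε : ℝ) : ℝ≥0∞ :=
  ⨆ (E : Finset X) (_ : IsSeparated T n ε E),
    ∑ x ∈ E, ENNReal.ofReal (Real.exp (birkhoffSum T φ n x))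

/-- The topological pressure
`P(φ) = lim_{ε → 0} limsup_n (1/n) log sup_E ∑_{x ∈ E} exp (S_n φ(x))`.
The inner expression increases as `ε` decreases to `0`, so the limit is the supremum over `ε > 0`. -/
def pressure (T : X → X) (φ : C(X, ℝ)) : EReal :=
  ⨆ (ε : ℝ) (_ : 0 < ε),
    limsup (fun n : ℕ => ENNReal.log (separatedSum T φ n ε) / (n : EReal)) atTop

end Pressure

/-! ### Regular pairs -/

section Regular

variable {X : Type*} [MetricSpace X] [MeasurableSpace X] {d : ℕ}

/-- `μ` is an equilibrium measure for `φ` with respect to the classical topological pressure. -/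
def IsEquilibriumMeasure (T : X → X) (φ : C(X, ℝ)) (μ : ProbabilityMeasure X) : Prop :=
  μ ∈ invariantMeasures T ∧
    pressure T φ = (metricEntropy T (μ : Measure X) : EReal) + ((∫ x, φ x ∂(μ : Measure X) : ℝ) : EReal)

/-- The vector `∫ Φ dμ = (∫ φ₁ dμ, …, ∫ φ_d dμ)`. -/
def integralVec (Φ : Fin d → C(X, ℝ)) (μ : ProbabilityMeasure X) : EuclideanSpace ℝ (Fin d) :=
  WithLp.toLp 2 fun i => ∫ x, Φ i x ∂(μ : Measure X)

/-- The set `L(Φ)` of all vectors `∫ Φ dμ` with `μ` invariant. -/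
def rotationSet (T : X → X) (Φ : Fin d → C(X, ℝ)) : Set (EuclideanSpace ℝ (Fin d)) :=
  integralVec Φ '' invariantMeasures T

/-- The set `M(z)` of invariant probability measures with `∫ Φ dμ = z`. -/
def levelMeasures (T : X → X) (Φ : Fin d → C(X, ℝ)) (z : EuclideanSpace ℝ (Fin d)) :
    Set (ProbabilityMeasure X) :=
  {μ ∈ invariantMeasures T | integralVec Φ μ = z}

/-- `h(z) = sup {h_μ(T) : μ ∈ M(z)}`, with values in `[0, ∞]`. -/
def levelEntropy (T : X → X) (Φ : Fin d → C(X, ℝ)) (z : EuclideanSpace ℝ (Fin d)) : ℝ≥0∞ :=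
  ⨆ μ ∈ levelMeasures T Φ z, metricEntropy T (μ : Measure X)

/-- The function `⟨q, Φ - z⟩ = ∑ qᵢ (φᵢ - zᵢ)`. -/
def pairing (Φ : Fin d → C(X, ℝ)) (q z : EuclideanSpace ℝ (Fin d)) : C(X, ℝ) :=
  ∑ i, q i • (Φ i - ContinuousMap.const X (z i))

/-- The pair `(T, Φ)` is `C^r`-regular; `r` ranges over `ℕ ∪ {∞, ω}`. -/
structure IsRegularPair [BorelSpace X] (r : WithTop ℕ∞) (T : X → X) (Φ : Fin d → C(X, ℝ)) :
    Prop where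
  /-- Each function in `span {φ₁, …, φ_d, 1}` has a unique equilibrium measure. -/
  existsUnique_equilibrium : ∀ ψ ∈ Submodule.span ℝ (Set.range Φ ∪ {1}),
    ∃! μ : ProbabilityMeasure X, IsEquilibriumMeasure T ψ μ
  /-- For `z ∈ int L(Φ)` the map `q ↦ P(⟨q, Φ - z⟩)` is real valued. -/
  pressure_finite : ∀ z ∈ interior (rotationSet T Φ), ∀ q,
    pressure T (pairing Φ q z) ≠ ⊤ ∧ pressure T (pairing Φ q z) ≠ ⊥
  /-- For `z ∈ int L(Φ)` the map `q ↦ P(⟨q, Φ - z⟩)` is of class `C^r`. -/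
  pressure_contDiff : ∀ z ∈ interior (rotationSet T Φ),
    ContDiff ℝ r fun q => (pressure T (pairing Φ q z)).toReal
  /-- For `z ∈ int L(Φ)` the map `q ↦ P(⟨q, Φ - z⟩)` is strictly convex. -/
  pressure_strictConvex : ∀ z ∈ interior (rotationSet T Φ),
    StrictConvexOn ℝ univ fun q => (pressure T (pairing Φ q z)).toReal
  /-- For `z ∈ int L(Φ)` the second derivative of `q ↦ P(⟨q, Φ - z⟩)` is positive definite. -/
  pressure_posDef : ∀ z ∈ interior (rotationSet T Φ), ∀ q v, v ≠ 0 →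
    0 < iteratedFDeriv ℝ 2 (fun q => (pressure T (pairing Φ q z)).toReal) q ![v, v]
  /-- The entropy map `μ ↦ h_μ(T)` is real valued on the invariant measures. -/
  entropy_finite : ∀ μ ∈ invariantMeasures T, metricEntropy T (μ : Measure X) ≠ ⊤
  /-- The entropy map is upper semicontinuous on the invariant measures, in the weak* topology. -/
  entropy_usc : UpperSemicontinuousOn
    (fun μ : ProbabilityMeasure X => (metricEntropy T (μ : Measure X)).toReal) (invariantMeasures T)

end Regular

end NonlinearPressure

end

/-!
Refining a finite partition increases its entropy, so `h_μ(T)` is a directed supremum of the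
entropies `h_μ(T, ξ)`, each of which is concave in `μ` because `t ↦ -t log t` is. Hence
`μ ↦ h_μ(T)` is concave, and so is its supremum over the fibres of the affine map `μ ↦ ∫ Φ dμ`.
For upper semicontinuity, the invariant measures are weak* compact, and the supremum of an upper
semicontinuous function on a compact set over the fibres of a continuous map is again upper
semicontinuous.
-/

open scoped NNReal

namespace NonlinearPressure

lemma liminf_add_liminf_le {ι : Type*} {l : Filter ι} (u v : ι → ℝ≥0∞) :
    liminf u l + liminf v l ≤ liminf (fun i => u i + v i) l := by
  simp only [liminf_eq_iSup_iInf]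
  exact ENNReal.biSup_add_biSup_le' ⟨univ, univ_mem⟩ ⟨univ, univ_mem⟩ fun s hs t ht =>
    le_iSup₂_of_le (s ∩ t) (inter_mem hs ht) <| le_iInf₂ fun i hi =>
      add_le_add (iInf₂_le i hi.1) (iInf₂_le i hi.2)

section ENNRealConcave

variable {E : Type*} [AddCommMonoid E] [SMul ℝ≥0 E] {s : Set E}

lemma concaveOn_ofReal {f : E → ℝ} (hf : ConcaveOn ℝ≥0 s f) (hf₀ : ∀ x ∈ s, 0 ≤ f x) :
    ConcaveOn ℝ≥0 s fun x => ENNReal.ofReal (f x) := by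
  refine ⟨hf.1, fun x hx y hy a b ha hb hab => ?_⟩
  calc a • ENNReal.ofReal (f x) + b • ENNReal.ofReal (f y)
      = ENNReal.ofReal (a • f x + b • f y) := by
        rw [ENNReal.ofReal_add (smul_nonneg ha (hf₀ x hx)) (smul_nonneg hb (hf₀ y hy))]
        simp only [NNReal.smul_def, smul_eq_mul, ENNReal.smul_def, ENNReal.ofReal_mul,
          NNReal.coe_nonneg, ENNReal.ofReal_coe_nnreal]
    _ ≤ ENNReal.ofReal (f (a • x + b • y)) := ENNReal.ofReal_le_ofReal (hf.2 hx hy ha hb hab)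

lemma concaveOn_liminf {ι : Type*} {l : Filter ι} [l.NeBot] {f : ι → E → ℝ≥0∞}
    (hs : Convex ℝ≥0 s) (hf : ∀ i, ConcaveOn ℝ≥0 s (f i)) :
    ConcaveOn ℝ≥0 s fun x => liminf (fun i => f i x) l := by
  refine ⟨hs, fun x hx y hy a b ha hb hab => ?_⟩
  calc a • liminf (fun i => f i x) l + b • liminf (fun i => f i y) l
      = liminf (fun i => a • f i x) l + liminf (fun i => b • f i y) l := by
        simp only [ENNReal.smul_def, smul_eq_mul,
          ENNReal.liminf_const_mul_of_ne_top ENNReal.coe_ne_top]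
    _ ≤ liminf (fun i => a • f i x + b • f i y) l := liminf_add_liminf_le _ _
    _ ≤ liminf (fun i => f i (a • x + b • y)) l :=
        liminf_le_liminf (Eventually.of_forall fun i => (hf i).2 hx hy ha hb hab)

lemma concaveOn_iSup_of_directed {ι : Type*} {f : ι → E → ℝ≥0∞} (hs : Convex ℝ≥0 s)
    (hf : ∀ i, ConcaveOn ℝ≥0 s (f i))
    (hdir : ∀ i j, ∃ k, ∀ x ∈ s, f i x ≤ f k x ∧ f j x ≤ f k x) :
    ConcaveOn ℝ≥0 s fun x => ⨆ i, f i x := by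
  refine ⟨hs, fun x hx y hy a b ha hb hab => ?_⟩
  simp only [ENNReal.smul_def, smul_eq_mul, ENNReal.mul_iSup]
  rw [ENNReal.iSup_add_iSup fun i j => ?_]
  · exact iSup_mono fun i => (hf i).2 hx hy ha hb hab
  · obtain ⟨k, hk⟩ := hdir i j
    exact ⟨k, by gcongr; exacts [(hk x hx).1, (hk y hy).2]⟩

end ENNRealConcave

lemma concaveOn_toReal {E : Type*} [AddCommMonoid E] [Module ℝ E] {s : Set E} {f : E → ℝ≥0∞}
    (hf : ConcaveOn ℝ≥0 s f) (hf_top : ∀ x ∈ s, f x ≠ ⊤) :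
    ConcaveOn ℝ s fun x => (f x).toReal := by
  refine ⟨fun x hx y hy a b ha hb hab => ?_, fun x hx y hy a b ha hb hab => ?_⟩ <;>
    lift a to ℝ≥0 using ha <;> lift b to ℝ≥0 using hb <;> norm_cast at hab
  · exact hf.1 hx hy zero_le zero_le hab
  · calc (a : ℝ) • (f x).toReal + (b : ℝ) • (f y).toReal
        = (a • f x + b • f y).toReal := by
          rw [ENNReal.toReal_add (ENNReal.nnreal_smul_ne_top (hf_top x hx))
            (ENNReal.nnreal_smul_ne_top (hf_top y hy))]
          simp only [ENNReal.smul_def, smul_eq_mul, ENNReal.toReal_mul, ENNReal.coe_toReal]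
      _ ≤ (f (a • x + b • y)).toReal :=
          ENNReal.toReal_mono (hf_top _ (hf.1 hx hy zero_le zero_le hab))
            (hf.2 hx hy zero_le zero_le hab)

lemma upperSemicontinuousOn_toReal_iff {α : Type*} [TopologicalSpace α] {s : Set α}
    {f : α → ℝ≥0∞} (hf : ∀ x ∈ s, f x ≠ ⊤) :
    UpperSemicontinuousOn (fun x => (f x).toReal) s ↔ UpperSemicontinuousOn f s := by
  refine ⟨fun h => ?_, fun h x hx c hc => ?_⟩
  · have hofReal := ENNReal.continuous_ofReal.comp_upperSemicontinuousOn h ENNReal.ofReal_mono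
    intro x hx c hc
    rw [← ENNReal.ofReal_toReal (hf x hx)] at hc
    filter_upwards [hofReal x hx c hc, self_mem_nhdsWithin] with y hy hys
    rwa [← ENNReal.ofReal_toReal (hf y hys)]
  · filter_upwards [h x hx _ ((ENNReal.lt_ofReal_iff_toReal_lt (hf x hx)).2 hc),
      self_mem_nhdsWithin] with y hy hys
    exact (ENNReal.lt_ofReal_iff_toReal_lt (hf y hys)).1 hy

lemma upperSemicontinuous_iSup_fiber {α β γ : Type*} [TopologicalSpace α] [TopologicalSpace β]
    [T2Space β] [CompleteLinearOrder γ] [DenselyOrdered γ] {K : Set α} {f : α → γ} {g : α → β}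
    (hK : IsCompact K) (hf : UpperSemicontinuousOn f K) (hg : ContinuousOn g K) :
    UpperSemicontinuous fun y => ⨆ x ∈ {x ∈ K | g x = y}, f x := by
  intro y c hc
  obtain ⟨b, hb, hbc⟩ := exists_between hc
  have hclosed : IsClosed (g '' (K ∩ f ⁻¹' Ici b)) :=
    ((hf.isCompact_inter_preimage_Ici hK b).image_of_continuousOn
      (hg.mono inter_subset_left)).isClosed
  have hy : y ∉ g '' (K ∩ f ⁻¹' Ici b) := by
    rintro ⟨x, ⟨hxK, hx⟩, hxy⟩
    exact hb.not_ge (le_iSup₂_of_le x ⟨hxK, hxy⟩ hx)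
  filter_upwards [hclosed.isOpen_compl.mem_nhds hy] with z hz
  refine (iSup₂_le fun x hx => ?_).trans_lt hbc
  by_contra! hbx
  exact hz ⟨x, ⟨hx.1, hbx.le⟩, hx.2⟩

section Entropy

variable {X : Type*} [MeasurableSpace X]

lemma convex_isFiniteMeasure : Convex ℝ≥0 {μ : Measure X | IsFiniteMeasure μ} := by
  rintro μ (_ : IsFiniteMeasure μ) ν (_ : IsFiniteMeasure ν) a b - - -
  exact inferInstanceAs (IsFiniteMeasure (a • μ + b • ν))

lemma convex_isProbabilityMeasure : Convex ℝ≥0 {μ : Measure X | IsProbabilityMeasure μ} := by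
  rintro μ (_ : IsProbabilityMeasure μ) ν (_ : IsProbabilityMeasure ν) a b - - hab
  refine ⟨?_⟩
  rw [Measure.add_apply, Measure.smul_apply, Measure.smul_apply, measure_univ, measure_univ,
    ← add_smul, hab, one_smul]

lemma negMulLog_sum_le {ι : Type*} {s : Finset ι} {p : ι → ℝ} (hp : ∀ i ∈ s, 0 ≤ p i) :
    Real.negMulLog (∑ i ∈ s, p i) ≤ ∑ i ∈ s, Real.negMulLog (p i) := by
  simp only [Real.negMulLog, neg_mul, Finset.sum_neg_distrib, neg_le_neg_iff, Finset.sum_mul]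
  refine Finset.sum_le_sum fun i hi => ?_
  rcases (hp i hi).eq_or_lt with h | h
  · rw [← h, zero_mul, zero_mul]
  · gcongr
    exact Finset.single_le_sum hp hi

lemma partitionEntropy_nonneg {ι : Type*} [Fintype ι] (μ : Measure X) [IsZeroOrProbabilityMeasure μ]
    (η : X → ι) : 0 ≤ partitionEntropy μ η :=
  Finset.sum_nonneg fun _ _ => Real.negMulLog_nonneg measureReal_nonneg measureReal_le_one

lemma partitionEntropy_comp_le {ι κ : Type*} [Fintype ι] [Fintype κ] (μ : Measure X)
    [IsFiniteMeasure μ] {η : X → ι} (hη : ∀ i, MeasurableSet (η ⁻¹' {i})) (f : ι → κ) :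
    partitionEntropy μ (f ∘ η) ≤ partitionEntropy μ η := by
  classical
  have hcell (k : κ) : μ.real (f ∘ η ⁻¹' {k}) = ∑ i with f i = k, μ.real (η ⁻¹' {i}) := by
    rw [sum_measureReal_preimage_singleton _ fun i _ => hη i]
    congr 1
    ext x
    simp
  calc partitionEntropy μ (f ∘ η)
      = ∑ k, Real.negMulLog (∑ i with f i = k, μ.real (η ⁻¹' {i})) := by
        simp only [partitionEntropy, hcell]
    _ ≤ ∑ k, ∑ i with f i = k, Real.negMulLog (μ.real (η ⁻¹' {i})) :=
        Finset.sum_le_sum fun k _ => negMulLog_sum_le fun _ _ => measureReal_nonneg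
    _ = partitionEntropy μ η := Finset.sum_fiberwise _ _ _

lemma concaveOn_partitionEntropy {ι : Type*} [Fintype ι] (η : X → ι) :
    ConcaveOn ℝ≥0 {μ : Measure X | IsFiniteMeasure μ} fun μ => partitionEntropy μ η := by
  refine ⟨convex_isFiniteMeasure, ?_⟩
  rintro μ (_ : IsFiniteMeasure μ) ν (_ : IsFiniteMeasure ν) a b - - hab
  simp only [partitionEntropy, Finset.smul_sum, ← Finset.sum_add_distrib]
  refine Finset.sum_le_sum fun i _ => ?_
  rw [measureReal_add_apply, measureReal_nnreal_smul_apply, measureReal_nnreal_smul_apply]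
  exact Real.concaveOn_negMulLog.2 (mem_Ici.2 measureReal_nonneg) (mem_Ici.2 measureReal_nonneg)
    a.coe_nonneg b.coe_nonneg (by exact_mod_cast hab)

lemma measurable_joinedLabel {k : ℕ} {T : X → X} (hT : Measurable T) {ξ : X → Fin k}
    (hξ : Measurable ξ) (n : ℕ) : Measurable (joinedLabel T ξ n) :=
  measurable_pi_lambda _ fun i => hξ.comp (hT.iterate i)

lemma entropyOfPartition_comp_le {k l : ℕ} {T : X → X} (hT : Measurable T) (μ : Measure X)
    [IsFiniteMeasure μ] {ξ : X → Fin k} (hξ : Measurable ξ) (f : Fin k → Fin l) :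
    entropyOfPartition T μ (f ∘ ξ) ≤ entropyOfPartition T μ ξ := by
  refine liminf_le_liminf (Eventually.of_forall fun n => ?_)
  have hcoarse : partitionEntropy μ (joinedLabel T (f ∘ ξ) n) ≤
      partitionEntropy μ (joinedLabel T ξ n) :=
    partitionEntropy_comp_le μ
      (fun c => measurable_joinedLabel hT hξ n (measurableSet_singleton c)) (f ∘ ·)
  gcongr

lemma concaveOn_entropyOfPartition {k : ℕ} (T : X → X) (ξ : X → Fin k) :
    ConcaveOn ℝ≥0 {μ : Measure X | IsProbabilityMeasure μ} fun μ => entropyOfPartition T μ ξ := by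
  refine concaveOn_liminf convex_isProbabilityMeasure fun n => concaveOn_ofReal ?_ ?_
  · have hconc := (concaveOn_partitionEntropy (joinedLabel T ξ n)).subset
      (fun μ (_ : IsProbabilityMeasure μ) => inferInstanceAs (IsFiniteMeasure μ))
      convex_isProbabilityMeasure
    have hdiv : (fun μ => partitionEntropy μ (joinedLabel T ξ n) / n) =
        fun μ => (n : ℝ≥0)⁻¹ • partitionEntropy μ (joinedLabel T ξ n) := by
      ext μ
      rw [NNReal.smul_def, NNReal.coe_inv, NNReal.coe_natCast, smul_eq_mul, div_eq_inv_mul]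
    rw [hdiv]
    exact hconc.smul zero_le
  · intro μ (_ : IsProbabilityMeasure μ)
    exact div_nonneg (partitionEntropy_nonneg μ _) n.cast_nonneg

lemma exists_common_refinement {k l : ℕ} {ξ : X → Fin k} {η : X → Fin l} (hξ : Measurable ξ)
    (hη : Measurable η) :
    ∃ (m : ℕ) (ζ : X → Fin m) (f : Fin m → Fin k) (g : Fin m → Fin l),
      Measurable ζ ∧ f ∘ ζ = ξ ∧ g ∘ ζ = η :=
  ⟨k * l, fun x => finProdFinEquiv (ξ x, η x), fun c => (finProdFinEquiv.symm c).1,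
    fun c => (finProdFinEquiv.symm c).2, (measurable_of_finite _).comp (hξ.prodMk hη),
    funext fun _ => congrArg Prod.fst (finProdFinEquiv.symm_apply_apply _),
    funext fun _ => congrArg Prod.snd (finProdFinEquiv.symm_apply_apply _)⟩

lemma concaveOn_metricEntropy {T : X → X} (hT : Measurable T) :
    ConcaveOn ℝ≥0 {μ : Measure X | IsProbabilityMeasure μ} (metricEntropy T) := by
  have hsup : metricEntropy T = fun μ =>
      ⨆ ξ : Σ k : ℕ, {ξ : X → Fin k // Measurable ξ}, entropyOfPartition T μ ξ.2.1 := by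
    ext μ
    simp only [metricEntropy, iSup_sigma, iSup_subtype]
  rw [hsup]
  refine concaveOn_iSup_of_directed convex_isProbabilityMeasure
    (fun ξ => concaveOn_entropyOfPartition T ξ.2.1) ?_
  rintro ⟨k, ξ, hξ⟩ ⟨l, η, hη⟩
  obtain ⟨m, ζ, f, g, hζ, rfl, rfl⟩ := exists_common_refinement hξ hη
  exact ⟨⟨m, ζ, hζ⟩, fun μ (_ : IsProbabilityMeasure μ) =>
    ⟨entropyOfPartition_comp_le hT μ hζ f, entropyOfPartition_comp_le hT μ hζ g⟩⟩

lemma exists_mem_invariantMeasures_coe_eq {T : X → X} {μ ν : ProbabilityMeasure X}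
    (hμ : μ ∈ invariantMeasures T) (hν : ν ∈ invariantMeasures T) {a b : ℝ≥0} (hab : a + b = 1) :
    ∃ ρ ∈ invariantMeasures T, (ρ : Measure X) = a • (μ : Measure X) + b • (ν : Measure X) :=
  ⟨⟨_, convex_isProbabilityMeasure μ.2 ν.2 zero_le zero_le hab⟩,
    (MeasurePreserving.smul_measure hμ a).add_measure (MeasurePreserving.smul_measure hν b), rfl⟩

end Entropy

lemma isClosed_invariantMeasures {X : Type*} [TopologicalSpace X] [HasOuterApproxClosed X]
    [MeasurableSpace X] [BorelSpace X] {T : X → X} (hT : Continuous T) :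
    IsClosed (invariantMeasures T) := by
  have hfix : invariantMeasures T =
      {μ : ProbabilityMeasure X | μ.map hT.measurable.aemeasurable = μ} := by
    ext μ
    rw [mem_ofPred_eq, ← ProbabilityMeasure.toMeasure_injective.eq_iff]
    exact ⟨fun h => h.map_eq, fun h => ⟨hT.measurable, h⟩⟩
  rw [hfix]
  exact isClosed_eq (ProbabilityMeasure.continuous_map hT) continuous_id

section LevelEntropy

variable {X : Type*} [MetricSpace X] [CompactSpace X] [MeasurableSpace X] {d : ℕ}

lemma continuous_integralVec [OpensMeasurableSpace X] (Φ : Fin d → C(X, ℝ)) :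
    Continuous (integralVec Φ) :=
  (PiLp.continuous_toLp 2 _).comp
    (continuous_pi fun i => ProbabilityMeasure.continuous_integral_continuousMap (Φ i))

lemma integralVec_of_coe_eq [OpensMeasurableSpace X] (Φ : Fin d → C(X, ℝ))
    {μ ν ρ : ProbabilityMeasure X} {a b : ℝ≥0}
    (hρ : (ρ : Measure X) = a • (μ : Measure X) + b • (ν : Measure X)) :
    integralVec Φ ρ = a • integralVec Φ μ + b • integralVec Φ ν := by
  have hint (i : Fin d) (m : Measure X) [IsFiniteMeasure m] : Integrable (Φ i) m :=
    (Φ i).continuous.integrable_of_hasCompactSupport (HasCompactSupport.of_compactSpace _)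
  ext i
  change ∫ x, Φ i x ∂(ρ : Measure X) =
    a • ∫ x, Φ i x ∂(μ : Measure X) + b • ∫ x, Φ i x ∂(ν : Measure X)
  rw [hρ, integral_add_measure (hint i _) (hint i _), integral_smul_nnreal_measure,
    integral_smul_nnreal_measure]

lemma convex_rotationSet [OpensMeasurableSpace X] (T : X → X) (Φ : Fin d → C(X, ℝ)) :
    Convex ℝ≥0 (rotationSet T Φ) := by
  rintro _ ⟨μ, hμ, rfl⟩ _ ⟨ν, hν, rfl⟩ a b - - hab
  obtain ⟨ρ, hρ, hρ_eq⟩ := exists_mem_invariantMeasures_coe_eq hμ hν hab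
  exact ⟨ρ, hρ, integralVec_of_coe_eq Φ hρ_eq⟩

lemma concaveOn_levelEntropy [OpensMeasurableSpace X] {T : X → X} (hT : Measurable T)
    (Φ : Fin d → C(X, ℝ)) : ConcaveOn ℝ≥0 (rotationSet T Φ) (levelEntropy T Φ) := by
  refine ⟨convex_rotationSet T Φ, fun y hy z hz a b ha hb hab => ?_⟩
  simp only [levelEntropy, ENNReal.smul_def, smul_eq_mul, ENNReal.mul_iSup]
  refine ENNReal.biSup_add_biSup_le' hy hz fun μ hμ ν hν => ?_
  obtain ⟨ρ, hρ, hρ_eq⟩ := exists_mem_invariantMeasures_coe_eq hμ.1 hν.1 hab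
  refine le_iSup₂_of_le ρ ⟨hρ, by rw [integralVec_of_coe_eq Φ hρ_eq, hμ.2, hν.2]⟩ ?_
  rw [hρ_eq]
  exact (concaveOn_metricEntropy hT).2 μ.2 ν.2 ha hb hab

variable [BorelSpace X]

lemma upperSemicontinuous_levelEntropy {T : X → X} (hT : Continuous T) (Φ : Fin d → C(X, ℝ))
    (husc : UpperSemicontinuousOn (fun μ : ProbabilityMeasure X => metricEntropy T (μ : Measure X))
      (invariantMeasures T)) :
    UpperSemicontinuous (levelEntropy T Φ) :=
  upperSemicontinuous_iSup_fiber (isClosed_invariantMeasures hT).isCompact husc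
    (continuous_integralVec Φ).continuousOn

lemma levelEntropy_ne_top {T : X → X} (hT : Continuous T) (Φ : Fin d → C(X, ℝ))
    (hfin : ∀ μ ∈ invariantMeasures T, metricEntropy T (μ : Measure X) ≠ ⊤)
    (husc : UpperSemicontinuousOn (fun μ : ProbabilityMeasure X => metricEntropy T (μ : Measure X))
      (invariantMeasures T))
    {z : EuclideanSpace ℝ (Fin d)} (hz : z ∈ rotationSet T Φ) : levelEntropy T Φ z ≠ ⊤ := by
  obtain ⟨μ, hμ, hmax⟩ := husc.exists_isMaxOn (image_nonempty.1 ⟨z, hz⟩)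
    (isClosed_invariantMeasures hT).isCompact
  exact ne_top_of_le_ne_top (hfin μ hμ) (iSup₂_le fun ν hν => hmax hν.1)

end LevelEntropy

end NonlinearPressure

open NonlinearPressure in
theorem mainTheorem7_general {X : Type*} [MetricSpace X] [CompactSpace X] [MeasurableSpace X]
    [BorelSpace X] {d : ℕ} {T : X → X} (hT : Continuous T) (Φ : Fin d → C(X, ℝ))
    (hfin : ∀ μ ∈ invariantMeasures T, metricEntropy T (μ : Measure X) ≠ ⊤)
    (husc : UpperSemicontinuousOn
      (fun μ : ProbabilityMeasure X => (metricEntropy T (μ : Measure X)).toReal)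
      (invariantMeasures T)) :
    (∀ z ∈ rotationSet T Φ, levelEntropy T Φ z ≠ ⊤) ∧
    UpperSemicontinuousOn (fun z => (levelEntropy T Φ z).toReal) (rotationSet T Φ) ∧
    ConcaveOn ℝ (rotationSet T Φ) (fun z => (levelEntropy T Φ z).toReal) := by
  have husc_ennreal := (upperSemicontinuousOn_toReal_iff hfin).1 husc
  have hlevel_fin : ∀ z ∈ rotationSet T Φ, levelEntropy T Φ z ≠ ⊤ := fun z hz =>
    levelEntropy_ne_top hT Φ hfin husc_ennreal hz
  have hlevel_usc : UpperSemicontinuous (levelEntropy T Φ) :=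
    upperSemicontinuous_levelEntropy hT Φ husc_ennreal
  exact ⟨hlevel_fin,
    (upperSemicontinuousOn_toReal_iff hlevel_fin).2 (hlevel_usc.upperSemicontinuousOn _),
    concaveOn_toReal (concaveOn_levelEntropy hT.measurable Φ) hlevel_fin⟩

theorem mainTheorem7 {X : Type*} [MetricSpace X] [CompactSpace X] [MeasurableSpace X]
    [BorelSpace X] {d : ℕ} (T : X → X) (hT : Continuous T) (Φ : Fin d → C(X, ℝ))
    (r : WithTop ℕ∞) (hr : 2 ≤ r) (hreg : NonlinearPressure.IsRegularPair r T Φ) :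
    (∀ z ∈ NonlinearPressure.rotationSet T Φ, NonlinearPressure.levelEntropy T Φ z ≠ ⊤) ∧
    UpperSemicontinuousOn (fun z => (NonlinearPressure.levelEntropy T Φ z).toReal)
      (NonlinearPressure.rotationSet T Φ) ∧
    ConcaveOn ℝ (NonlinearPressure.rotationSet T Φ)
      (fun z => (NonlinearPressure.levelEntropy T Φ z).toReal) :=
  mainTheorem7_general hT Φ hreg.entropy_finite hreg.entropy_usc
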